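/- Let $M$ be a (finite-dimensional) complex manifold and let $D\subset TM$ be a distribution, that is, a holomorphic vector subbundle of the tangent bundle. For $x\in M$, let $\mathrm{Levi}^D_x:\wedge^2 D_x\to T_xM/D_x$ be the Levi tensor, given by $\mathrm{Levi}^D_x(\vec u(x),\vec v(x))=[\vec u,\vec v](x)\bmod D_x$ for holomorphic local sections $\vec u,\vec v$ of $D$ near $x$. Let $\pi_M:T^\vee M\to M$ be the cotangent bundle, let $\theta^M$ be its canonical $1$-form, $\theta^M_\beta(v)=\beta(d\pi_M(v))$ for $v\in T_\beta(T^\vee M)$, and let $d\theta^M$ be the canonical symplectic form. Let $D^\perp\subset T^\vee M$ be the subbundle of cotangent vectors that annihilate $D$, let $\phi:D^\perp\to M$ be the natural projection, and put $T^\phi_\alpha:=\mathrm{Ker}(d_\alpha\phi)\subset T_\alpha D^\perp$. For $x\in M$ and $\alpha\in D^\perp_x$, regarded also as a linear form on $T_xM/D_x$, define $$\mathrm{Null}(d\theta^M|_{T_\alpha D^\perp}):=\{v\in T_\alpha D^\perp : d\theta^M(v,u)=0\ \text{ for all } u\in T_\alpha D^\perp\},$$ $$\mathrm{Null}(\alpha\circ\mathrm{Levi}^D_x):=\{v\in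 D_x : \alpha(\mathrm{Levi}^D_x(v,u))=0\ \text{ for all } u\in D_x\}.$$ Then, for every $x\in M$ and every nonzero $\alpha\in D^\perp_x$: (i) $\mathrm{Null}(d\theta^M|_{T_\alpha D^\perp})\cap T^\phi_\alpha=0$; (ii) the differential $d_\alpha\phi:T_\alpha D^\perp\to T_xM$ restricts to a linear isomorphism $$\mathrm{Null}(d\theta^M|_{T_\alpha D^\perp})\;\cong\;\mathrm{Null}(\alpha\circ\mathrm{Levi}^D_x)\subset D_x\subset T_xM.$$ In particular, $\mathrm{Null}(d\theta^M|_{T_\alpha D^\perp})\subset\mathrm{Ker}(\theta^M_\alpha)$. -/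

import Mathlib

open Set Filter Bundle VectorField
open scoped Manifold Topology ContDiff Bundle

noncomputable section

/-! ### Alternating two-forms on a vector space -/

section LinearAlgebra

variable {V : Type*} [AddCommGroup V] [Module ℂ V]

/-- The null space `{v | β(v, u) = 0 for all u}` of an alternating two-form `β`. -/
def nullSpace (β : V [⋀^Fin 2]→ₗ[ℂ] ℂ) : Submodule ℂ V where
  carrier := {v | ∀ u, β ![v, u] = 0}
  zero_mem' u := β.map_coord_zero (m := ![0, u]) 0 rfl
  add_mem' {v w} hv hw u := by
    have h := β.map_vecCons_add (m := ![u]) v w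
    rw [h, hv u, hw u, add_zero]
  smul_mem' c v hv u := by
    have h := β.map_vecCons_smul (m := ![u]) c v
    rw [h, hv u, smul_zero]

end LinearAlgebra

/-! ### Differential forms and tangent spaces of subsets on a complex manifold -/

section Manifold

variable {F : Type*} [NormedAddCommGroup F] [NormedSpace ℂ F] {H : Type*} [TopologicalSpace H]
  (I : ModelWithCorners ℂ F H) {N : Type*} [TopologicalSpace N] [ChartedSpace H N]

/-- The exterior derivative of a one-form `η` on a manifold at the point `p`: read `η` in the
preferred chart at `p`, take the exterior derivative in the model vector space, and pull the result
back to the tangent space at `p`. The normalization is `dη(X, Y) = X η(Y) - Y η(X) - η([X, Y])`. -/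
def exteriorDeriv (η : ∀ p : N, TangentSpace I p →L[ℂ] ℂ) (p : N) :
    TangentSpace I p [⋀^Fin 2]→L[ℂ] ℂ :=
  (extDerivWithin
      (fun y : F ↦ ContinuousAlternatingMap.ofSubsingleton ℂ F ℂ (0 : Fin 1)
        ((η ((extChartAt I p).symm y)).comp
          (mfderivWithin 𝓘(ℂ, F) I (extChartAt I p).symm (range I) y)))
      (range I) (extChartAt I p p)).compContinuousLinearMap
    (mfderiv I 𝓘(ℂ, F) (extChartAt I p) p)

/-- The tangent space at `p` of a submanifold `S` of `N`, as a subspace of the tangent space of `N`: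
the tangent vectors on which the differentials of all holomorphic functions defined near `p` and
vanishing on `S` near `p` vanish. -/
def submanifoldTangentSpace (S : Set N) (p : N) : Submodule ℂ (TangentSpace I p) where
  carrier := {v | ∀ f : N → ℂ, ContMDiffAt I 𝓘(ℂ, ℂ) ω f p → (∀ᶠ q in 𝓝 p, q ∈ S → f q = 0) →
    mfderiv I 𝓘(ℂ, ℂ) f p v = 0}
  zero_mem' f _ _ := map_zero _
  add_mem' {v w} hv hw f hf h := by rw [map_add, hv f hf h, hw f hf h, add_zero]
  smul_mem' c v hv f hf h := by rw [map_smul, hv f hf h, smul_zero]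

end Manifold

/-! ### The cotangent bundle and its canonical forms -/

section Cotangent

variable (E : Type*) [NormedAddCommGroup E] [NormedSpace ℂ E]
  (M : Type*) [TopologicalSpace M] [ChartedSpace E M] [IsManifold 𝓘(ℂ, E) ω M]

/-- The holomorphic cotangent bundle of a complex manifold `M` modelled on `E`. -/
abbrev CotangentBundle : Type _ :=
  TotalSpace (E →L[ℂ] ℂ) (fun x : M ↦ TangentSpace 𝓘(ℂ, E) x →L[ℂ] ℂ)

/-- The model of the cotangent bundle as a complex manifold. -/
abbrev cotangentModel : ModelWithCorners ℂ (E × (E →L[ℂ] ℂ)) (ModelProd E (E →L[ℂ] ℂ)) :=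
  𝓘(ℂ, E).prod 𝓘(ℂ, E →L[ℂ] ℂ)

variable {E M}

/-- The differential at `a` of the projection of the cotangent bundle onto `M`. -/
def cotangentProjDeriv (a : CotangentBundle E M) :
    TangentSpace (cotangentModel E) a →L[ℂ] TangentSpace 𝓘(ℂ, E) a.proj :=
  mfderiv (cotangentModel E) 𝓘(ℂ, E) (fun b : CotangentBundle E M ↦ b.proj) a

/-- The canonical one-form of the cotangent bundle, `v ↦ a (dπ v)` at the point `a`. -/
def canonicalOneForm (a : CotangentBundle E M) : TangentSpace (cotangentModel E) a →L[ℂ] ℂ :=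
  ContinuousLinearMap.comp a.snd (cotangentProjDeriv a)

/-- The canonical symplectic form of the cotangent bundle, the exterior derivative of the
canonical one-form. -/
def canonicalTwoForm (a : CotangentBundle E M) :
    TangentSpace (cotangentModel E) a [⋀^Fin 2]→L[ℂ] ℂ :=
  exteriorDeriv (cotangentModel E) (fun b : CotangentBundle E M ↦ canonicalOneForm b) a

end Cotangent

/-! ### Distributions and the Levi tensor -/

/-- A distribution on a complex manifold `M`: a holomorphic vector subbundle of the tangent bundle,
that is, a family of subspaces of the tangent spaces which locally has a holomorphic frame. -/
structure HolomorphicDistribution (E : Type*) [NormedAddCommGroup E] [NormedSpace ℂ E]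
    (M : Type*) [TopologicalSpace M] [ChartedSpace E M] [IsManifold 𝓘(ℂ, E) ω M] where
  fiber : ∀ x : M, Submodule ℂ (TangentSpace 𝓘(ℂ, E) x)
  exists_frame : ∀ x : M, ∃ (U : Set M) (r : ℕ) (s : Fin r → ∀ y : M, TangentSpace 𝓘(ℂ, E) y),
    IsOpen U ∧ x ∈ U ∧
    (∀ i, ContMDiffOn 𝓘(ℂ, E) 𝓘(ℂ, E).tangent ω
      (fun y ↦ (⟨y, s i y⟩ : TangentBundle 𝓘(ℂ, E) M)) U) ∧
    ∀ y ∈ U, LinearIndependent ℂ (fun i ↦ s i y) ∧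
      Submodule.span ℂ (range fun i ↦ s i y) = fiber y

namespace HolomorphicDistribution

variable {E : Type*} [NormedAddCommGroup E] [NormedSpace ℂ E]
  {M : Type*} [TopologicalSpace M] [ChartedSpace E M] [IsManifold 𝓘(ℂ, E) ω M]
  (D : HolomorphicDistribution E M)

/-- `X` is a holomorphic local section of the distribution `D` near `x`. -/
structure IsLocalSection (x : M) (X : ∀ y : M, TangentSpace 𝓘(ℂ, E) y) : Prop where
  holomorphic : ContMDiffAt 𝓘(ℂ, E) 𝓘(ℂ, E).tangent ω
    (fun y ↦ (⟨y, X y⟩ : TangentBundle 𝓘(ℂ, E) M)) x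
  mem : ∀ᶠ y in 𝓝 x, X y ∈ D.fiber y

variable {D}

theorem IsLocalSection.mdifferentiableAt {x : M} {X : ∀ y : M, TangentSpace 𝓘(ℂ, E) y}
    (hX : D.IsLocalSection x X) : MDifferentiableAt 𝓘(ℂ, E) 𝓘(ℂ, E).tangent
      (fun y ↦ (⟨y, X y⟩ : TangentBundle 𝓘(ℂ, E) M)) x :=
  hX.holomorphic.mdifferentiableAt (by simp)

theorem IsLocalSection.add {x : M} {X Y : ∀ y : M, TangentSpace 𝓘(ℂ, E) y}
    (hX : D.IsLocalSection x X) (hY : D.IsLocalSection x Y) : D.IsLocalSection x (X + Y) where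
  holomorphic := hX.holomorphic.add_section hY.holomorphic
  mem := by
    filter_upwards [hX.mem, hY.mem] with y h1 h2 using Submodule.add_mem _ h1 h2

theorem IsLocalSection.const_smul {x : M} {X : ∀ y : M, TangentSpace 𝓘(ℂ, E) y}
    (c : ℂ) (hX : D.IsLocalSection x X) : D.IsLocalSection x (c • X) where
  holomorphic := hX.holomorphic.const_smul_section
  mem := by
    filter_upwards [hX.mem] with y h1 using Submodule.smul_mem _ c h1

variable (D) in
theorem exists_isLocalSection (x : M) (v : D.fiber x) :
    ∃ X : ∀ y : M, TangentSpace 𝓘(ℂ, E) y, D.IsLocalSection x X ∧ X x = v := by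
  obtain ⟨U, r, s, hU, hx, hs, hspan⟩ := D.exists_frame x
  obtain ⟨c, hc⟩ := (Submodule.mem_span_range_iff_exists_fun ℂ).1 ((hspan x hx).2.ge v.2)
  refine ⟨fun y ↦ ∑ i, c i • s i y, ⟨?_, ?_⟩, hc⟩
  · exact ContMDiffAt.sum_section fun i _ ↦
      ((hs i).contMDiffAt (hU.mem_nhds hx)).const_smul_section
  · filter_upwards [hU.mem_nhds hx] with y hy
    rw [← (hspan y hy).2]
    exact Submodule.sum_mem _ fun i _ ↦
      Submodule.smul_mem _ _ (Submodule.subset_span (mem_range_self i))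

variable (D)

/-- A holomorphic local section of `D` near `x` with the value `v` at `x`. -/
def extension (x : M) (v : D.fiber x) : ∀ y : M, TangentSpace 𝓘(ℂ, E) y :=
  (D.exists_isLocalSection x v).choose

theorem isLocalSection_extension (x : M) (v : D.fiber x) :
    D.IsLocalSection x (D.extension x v) :=
  (D.exists_isLocalSection x v).choose_spec.1

theorem extension_self (x : M) (v : D.fiber x) : D.extension x v x = v :=
  (D.exists_isLocalSection x v).choose_spec.2

/-- The Lie bracket at `x`, modulo `D_x`, of local sections of `D` with the values `u` and `v`. -/
def bracketMod (x : M) (u v : D.fiber x) : TangentSpace 𝓘(ℂ, E) x ⧸ D.fiber x :=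
  (D.fiber x).mkQ (mlieBracket 𝓘(ℂ, E) (D.extension x u) (D.extension x v) x)

theorem bracketMod_self (x : M) (u : D.fiber x) : D.bracketMod x u u = 0 := by
  simp [bracketMod]

theorem bracketMod_swap (x : M) (u v : D.fiber x) :
    D.bracketMod x u v = - D.bracketMod x v u := by
  rw [bracketMod, bracketMod, mlieBracket_swap_apply, map_neg]

variable {D}

variable [FiniteDimensional ℂ E]

/-- Near `x`, a local section of `D` is a combination of a frame with differentiable coefficients. -/
theorem IsLocalSection.exists_coeff {x : M} {X : ∀ y : M, TangentSpace 𝓘(ℂ, E) y}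
    (hX : D.IsLocalSection x X) {U : Set M} {r : ℕ}
    {s : Fin r → ∀ y : M, TangentSpace 𝓘(ℂ, E) y} (hU : IsOpen U) (hx : x ∈ U)
    (hs : ∀ i, ContMDiffOn 𝓘(ℂ, E) 𝓘(ℂ, E).tangent ω
      (fun y ↦ (⟨y, s i y⟩ : TangentBundle 𝓘(ℂ, E) M)) U)
    (hspan : ∀ y ∈ U, LinearIndependent ℂ (fun i ↦ s i y) ∧
      Submodule.span ℂ (range fun i ↦ s i y) = D.fiber y) :
    ∃ f : Fin r → M → ℂ, (∀ i, MDifferentiableAt 𝓘(ℂ, E) 𝓘(ℂ, ℂ) (f i) x) ∧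
      ∀ᶠ y in 𝓝 x, X y = ∑ i, f i y • s i y := by
  classical
  have : CompleteSpace E := FiniteDimensional.complete ℂ E
  let t := trivializationAt E (TangentSpace 𝓘(ℂ, E) : M → Type _) x
  have hxt : x ∈ t.baseSet := FiberBundle.mem_baseSet_trivializationAt E _ x
  -- the frame and the section in the trivialization
  let A : M → Fin r → E := fun y j ↦ (t ⟨y, s j y⟩).2
  let Z : M → E := fun y ↦ (t ⟨y, X y⟩).2
  have hA : MDifferentiableAt 𝓘(ℂ, E) 𝓘(ℂ, Fin r → E) A x := by
    have h : ContMDiffAt 𝓘(ℂ, E) 𝓘(ℂ, Fin r → E) ω A x := contMDiffAt_pi_space.2 fun j ↦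
      (contMDiffAt_section x).1 ((hs j).contMDiffAt (hU.mem_nhds hx))
    exact h.mdifferentiableAt (by simp)
  have hZ : MDifferentiableAt 𝓘(ℂ, E) 𝓘(ℂ, E) Z x :=
    (mdifferentiableAt_section _ _).1 hX.mdifferentiableAt
  have hlin : ∀ y ∈ t.baseSet, ∀ c : Fin r → ℂ,
      (t ⟨y, ∑ j, c j • s j y⟩).2 = ∑ j, c j • A y j := by
    intro y hy c
    have h (v : TangentSpace 𝓘(ℂ, E) y) : (t ⟨y, v⟩).2 = t.continuousLinearEquivAt ℂ y hy v := rfl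
    simp only [A, h, map_sum, map_smul]
  have hAx : LinearIndependent ℂ (A x) :=
    (hspan x hx).1.map' (t.continuousLinearEquivAt ℂ x hxt).toLinearEquiv.toLinearMap
      (LinearEquiv.ker _)
  obtain ⟨L₀, hL₀⟩ := LinearMap.exists_leftInverse_of_injective
    (Fintype.linearCombination ℂ (A x)) (by
      rw [LinearMap.ker_eq_bot]
      exact hAx.fintypeLinearCombination_injective)
  let L : E →L[ℂ] (Fin r → ℂ) := LinearMap.toContinuousLinearMap L₀
  have hL : ∀ c : Fin r → ℂ, L (∑ j, c j • A x j) = c := fun c ↦ by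
    simpa [L, Fintype.linearCombination_apply] using LinearMap.congr_fun hL₀ c
  let B : (Fin r → E) → ((Fin r → ℂ) →L[ℂ] (Fin r → ℂ)) := fun a ↦
    ∑ j, (ContinuousLinearMap.proj j : (Fin r → ℂ) →L[ℂ] ℂ).smulRight (L (a j))
  have hB : ∀ a c, B a c = L (∑ j, c j • a j) := fun a c ↦ by
    simp [B, map_sum, map_smul]
  have hBx : B (A x) = 1 := by
    ext1 c
    rw [hB, hL]
    rfl
  have hBd : Differentiable ℂ B := by
    let Bl : (Fin r → E) →ₗ[ℂ] ((Fin r → ℂ) →L[ℂ] (Fin r → ℂ)) :=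
      { toFun := B
        map_add' := fun a b ↦ by
          ext1 c
          simp [hB, smul_add, Finset.sum_add_distrib]
        map_smul' := fun k a ↦ by
          ext1 c
          simp only [hB, Pi.smul_apply, RingHom.id_apply, smul_apply,
            ← map_smul, Finset.smul_sum]
          simp only [smul_comm k] }
    exact (LinearMap.toContinuousLinearMap Bl).differentiable
  have hunit : IsUnit (B (A x)) := hBx ▸ isUnit_one
  have hBM : MDifferentiableAt 𝓘(ℂ, E) 𝓘(ℂ, (Fin r → ℂ) →L[ℂ] (Fin r → ℂ))
      (fun y ↦ Ring.inverse (B (A y))) x :=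
    DifferentiableAt.comp_mdifferentiableAt (g := fun a ↦ Ring.inverse (B a)) (f := A)
      (hBd.differentiableAt.inverse hunit) hA
  have hLZ : MDifferentiableAt 𝓘(ℂ, E) 𝓘(ℂ, Fin r → ℂ) (fun y ↦ L (Z y)) x :=
    DifferentiableAt.comp_mdifferentiableAt (g := L) (f := Z) L.differentiableAt hZ
  refine ⟨fun i y ↦ Ring.inverse (B (A y)) (L (Z y)) i, ?_, ?_⟩
  · intro i
    exact DifferentiableAt.comp_mdifferentiableAt
      (g := (ContinuousLinearMap.proj i : (Fin r → ℂ) →L[ℂ] ℂ))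
      (ContinuousLinearMap.differentiableAt _) (hBM.clm_apply hLZ)
  · have h1 : ∀ᶠ y in 𝓝 x, IsUnit (B (A y)) :=
      (hBd.continuous.continuousAt.comp hA.continuousAt).eventually
        (Units.isOpen.mem_nhds hunit)
    filter_upwards [h1, hU.mem_nhds hx, t.open_baseSet.mem_nhds hxt, hX.mem] with y hy hyU hyt hyX
    rw [← (hspan y hyU).2, Submodule.mem_span_range_iff_exists_fun] at hyX
    obtain ⟨c, hc⟩ := hyX
    have hZy : L (Z y) = B (A y) c := by
      rw [hB, ← hlin y hyt c, hc]
    have : Ring.inverse (B (A y)) (L (Z y)) = c := by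
      rw [hZy]
      exact DFunLike.congr_fun (Ring.inverse_mul_cancel _ hy) c
    rw [this, hc]

theorem IsLocalSection.mlieBracket_mem {x : M} {X Y : ∀ y : M, TangentSpace 𝓘(ℂ, E) y}
    (hX : D.IsLocalSection x X) (hX0 : X x = 0) :
    mlieBracket 𝓘(ℂ, E) X Y x ∈ D.fiber x := by
  have : CompleteSpace E := FiniteDimensional.complete ℂ E
  obtain ⟨U, r, s, hU, hx, hs, hspan⟩ := D.exists_frame x
  obtain ⟨f, hf, hXf⟩ := hX.exists_coeff hU hx hs hspan
  have hsd : ∀ i, MDifferentiableAt 𝓘(ℂ, E) 𝓘(ℂ, E).tangent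
      (fun y ↦ (⟨y, s i y⟩ : TangentBundle 𝓘(ℂ, E) M)) x := fun i ↦
    ((hs i).contMDiffAt (hU.mem_nhds hx)).mdifferentiableAt (by simp)
  have hf0 : ∀ i, f i x = 0 := by
    have h := hXf.self_of_nhds
    rw [hX0] at h
    exact Fintype.linearIndependent_iff.1 (hspan x hx).1 _ h.symm
  have hsm : ∀ i, s i x ∈ D.fiber x := fun i ↦ by
    rw [← (hspan x hx).2]
    exact Submodule.subset_span (mem_range_self i)
  have key : ∀ T : Finset (Fin r),
      mlieBracket 𝓘(ℂ, E) (fun y ↦ ∑ i ∈ T, f i y • s i y) Y x ∈ D.fiber x := by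
    classical
    intro T
    induction T using Finset.induction_on with
    | empty =>
      have : (fun y : M ↦ ∑ i ∈ (∅ : Finset (Fin r)), f i y • s i y) =
          (0 : ∀ y : M, TangentSpace 𝓘(ℂ, E) y) := by
        funext y
        simp
      rw [this, mlieBracket_zero_left]
      exact Submodule.zero_mem _
    | insert a T ha ih =>
      have : (fun y : M ↦ ∑ i ∈ insert a T, f i y • s i y) =
          (f a • s a) + (fun y : M ↦ ∑ i ∈ T, f i y • s i y) := by
        funext y
        simp [Finset.sum_insert ha]
      have hsum : MDifferentiableAt 𝓘(ℂ, E) 𝓘(ℂ, E).tangent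
          (fun y ↦ (⟨y, ∑ i ∈ T, f i y • s i y⟩ : TangentBundle 𝓘(ℂ, E) M)) x :=
        MDifferentiableAt.sum_section fun i _ ↦ (hf i).smul_section (hsd i)
      rw [this, mlieBracket_add_left ((hf a).smul_section (hsd a)) hsum,
        mlieBracket_smul_left (hf a) (hsd a), hf0 a, zero_smul, add_zero]
      exact Submodule.add_mem _ (Submodule.smul_mem _ _ (hsm a)) ih
  have hXe : X =ᶠ[𝓝 x] fun y ↦ ∑ i, f i y • s i y := hXf
  rw [hXe.mlieBracket_vectorField_eq (EventuallyEq.refl _ Y)]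
  exact key Finset.univ

/-- The class modulo `D` of the bracket of two local sections depends only on their values. -/
theorem IsLocalSection.mkQ_mlieBracket_congr {x : M}
    {X X' Y Y' : ∀ y : M, TangentSpace 𝓘(ℂ, E) y}
    (hX : D.IsLocalSection x X) (hX' : D.IsLocalSection x X') (hXX' : X x = X' x)
    (hY : D.IsLocalSection x Y) (hY' : D.IsLocalSection x Y') (hYY' : Y x = Y' x) :
    (D.fiber x).mkQ (mlieBracket 𝓘(ℂ, E) X Y x) =
      (D.fiber x).mkQ (mlieBracket 𝓘(ℂ, E) X' Y' x) := by
  have : CompleteSpace E := FiniteDimensional.complete ℂ E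
  have left : ∀ {X X' Y : ∀ y : M, TangentSpace 𝓘(ℂ, E) y}, D.IsLocalSection x X →
      D.IsLocalSection x X' → X x = X' x →
      (D.fiber x).mkQ (mlieBracket 𝓘(ℂ, E) X Y x) =
        (D.fiber x).mkQ (mlieBracket 𝓘(ℂ, E) X' Y x) := by
    intro X X' Y hX hX' h
    have hd : D.IsLocalSection x (X + (-1 : ℂ) • X') := hX.add (hX'.const_smul _)
    have h0 : (X + (-1 : ℂ) • X') x = 0 := by simp [h]
    have hm := hd.mlieBracket_mem (Y := Y) h0
    rw [mlieBracket_add_left hX.mdifferentiableAt (hX'.const_smul _).mdifferentiableAt,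
      mlieBracket_const_smul_left hX'.mdifferentiableAt, neg_one_smul, ← sub_eq_add_neg] at hm
    exact (Submodule.Quotient.eq _).2 hm
  rw [left hX hX' hXX', mlieBracket_swap_apply (V := X') (W := Y),
    mlieBracket_swap_apply (V := X') (W := Y'), map_neg, map_neg, left hY hY' hYY']

variable (D)

variable {D} in
theorem bracketMod_eq {x : M} {u v : D.fiber x} {X Y : ∀ y : M, TangentSpace 𝓘(ℂ, E) y}
    (hX : D.IsLocalSection x X) (hXu : X x = u) (hY : D.IsLocalSection x Y) (hYv : Y x = v) :
    D.bracketMod x u v = (D.fiber x).mkQ (mlieBracket 𝓘(ℂ, E) X Y x) :=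
  (D.isLocalSection_extension x u).mkQ_mlieBracket_congr hX
    ((D.extension_self x u).trans hXu.symm) (D.isLocalSection_extension x v) hY
    ((D.extension_self x v).trans hYv.symm)

theorem bracketMod_add_left (x : M) (u u' v : D.fiber x) :
    D.bracketMod x (u + u') v = D.bracketMod x u v + D.bracketMod x u' v := by
  have : CompleteSpace E := FiniteDimensional.complete ℂ E
  have hu := D.isLocalSection_extension x u
  have hu' := D.isLocalSection_extension x u'
  rw [bracketMod_eq (hu.add hu') (by simp [extension_self]) (D.isLocalSection_extension x v)
    (D.extension_self x v), mlieBracket_add_left hu.mdifferentiableAt hu'.mdifferentiableAt, map_add]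
  rfl

theorem bracketMod_smul_left (x : M) (c : ℂ) (u v : D.fiber x) :
    D.bracketMod x (c • u) v = c • D.bracketMod x u v := by
  have : CompleteSpace E := FiniteDimensional.complete ℂ E
  have hu := D.isLocalSection_extension x u
  rw [bracketMod_eq (hu.const_smul c) (by simp [extension_self]) (D.isLocalSection_extension x v)
    (D.extension_self x v), mlieBracket_const_smul_left hu.mdifferentiableAt, map_smul]
  rfl

theorem bracketMod_add_right (x : M) (u v v' : D.fiber x) :
    D.bracketMod x u (v + v') = D.bracketMod x u v + D.bracketMod x u v' := by
  rw [bracketMod_swap, bracketMod_add_left, neg_add, ← bracketMod_swap, ← bracketMod_swap]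

theorem bracketMod_smul_right (x : M) (c : ℂ) (u v : D.fiber x) :
    D.bracketMod x u (c • v) = c • D.bracketMod x u v := by
  rw [bracketMod_swap, bracketMod_smul_left, D.bracketMod_swap x u v, smul_neg]

/-- The Levi tensor of the distribution `D` at `x`, the alternating bilinear map
`D_x × D_x → T_x M / D_x` induced by the Lie brackets of local sections of `D`. -/
def levi (x : M) : D.fiber x [⋀^Fin 2]→ₗ[ℂ] (TangentSpace 𝓘(ℂ, E) x ⧸ D.fiber x) where
  toFun v := D.bracketMod x (v 0) (v 1)
  map_update_add' := by
    intro _ m i u v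
    fin_cases i <;> simp [bracketMod_add_left, bracketMod_add_right]
  map_update_smul' := by
    intro _ m i c u
    fin_cases i <;> simp [bracketMod_smul_left, bracketMod_smul_right]
  map_eq_zero_of_eq' := by
    intro v i j h hij
    have h01 : v 0 = v 1 := by
      fin_cases i <;> fin_cases j <;> simp_all
    rw [h01, bracketMod_self]

/-- The Levi tensor is computed by arbitrary local sections of `D`. -/
theorem levi_apply {x : M} {X Y : ∀ y : M, TangentSpace 𝓘(ℂ, E) y}
    (hX : D.IsLocalSection x X) (hY : D.IsLocalSection x Y) :
    D.levi x ![⟨X x, hX.mem.self_of_nhds⟩, ⟨Y x, hY.mem.self_of_nhds⟩] =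
      (D.fiber x).mkQ (mlieBracket 𝓘(ℂ, E) X Y x) :=
  bracketMod_eq hX rfl hY rfl

/-- The cotangent vectors at `x` annihilating `D_x`. -/
def annihilator (x : M) : Submodule ℂ (TangentSpace 𝓘(ℂ, E) x →L[ℂ] ℂ) where
  carrier := {α | ∀ v ∈ D.fiber x, α v = 0}
  zero_mem' _ _ := rfl
  add_mem' {α β} hα hβ v hv := by
    rw [add_apply, hα v hv, hβ v hv, add_zero]
  smul_mem' c α hα v hv := by
    rw [smul_apply, hα v hv, smul_zero]

/-- The subbundle of the cotangent bundle of the cotangent vectors annihilating `D`. -/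
def perp : Set (CotangentBundle E M) := {a | a.snd ∈ D.annihilator a.proj}

/-- The linear form on `T_x M / D_x` corresponding to `α` in the annihilator of `D_x`. -/
def quotientForm {x : M} (α : D.annihilator x) :
    (TangentSpace 𝓘(ℂ, E) x ⧸ D.fiber x) →ₗ[ℂ] ℂ :=
  (D.fiber x).liftQ (α : TangentSpace 𝓘(ℂ, E) x →L[ℂ] ℂ).toLinearMap fun v hv ↦ α.2 v hv

/-- The alternating form on `D_x` given by the Levi tensor followed by `α`. -/
def leviForm {x : M} (α : D.annihilator x) : D.fiber x [⋀^Fin 2]→ₗ[ℂ] ℂ :=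
  (D.quotientForm α).compAlternatingMap (D.levi x)

/-- The tangent space at `a` of the submanifold `D.perp` of the cotangent bundle. -/
abbrev perpTangent (a : CotangentBundle E M) : Submodule ℂ (TangentSpace (cotangentModel E) a) :=
  submanifoldTangentSpace (cotangentModel E) D.perp a

/-- The differential at `a` of the projection of `D.perp` onto `M`. -/
def perpProjDeriv (a : CotangentBundle E M) :
    D.perpTangent a →ₗ[ℂ] TangentSpace 𝓘(ℂ, E) a.proj :=
  (cotangentProjDeriv a).toLinearMap.domRestrict (D.perpTangent a)

/-- The restriction of the canonical symplectic form to the tangent space of `D.perp` at `a`. -/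
def perpTwoForm (a : CotangentBundle E M) : D.perpTangent a [⋀^Fin 2]→ₗ[ℂ] ℂ :=
  (canonicalTwoForm a).toAlternatingMap.compLinearMap (D.perpTangent a).subtype

end HolomorphicDistribution

end

/-! ### Exterior derivatives, annihilating curves and the null-vector computation in a vector space.
-/

section VectorSpace

variable {E : Type*} [NormedAddCommGroup E] [NormedSpace ℂ E]

/-! Everything is computed in the coordinates (q, p) on the cotangent bundle induced by the chart of
M at x. There the symplectic form pairs (u, w) and (u', w') to w(u') - w'(u)
(`canonicalTwoForm_apply`). For a local frame S_i of D with derivatives A_i at x, D^⊥ is cut out by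
p(S_i(q)) = 0, and its tangent space at α by w(S_i) + α(A_i u) = 0 (`mem_perpTangent_iff`). Since
that space is defined through test functions, sufficiency of these equations needs actual curves in
D^⊥ (`exists_curve_annihilating`).

The heart is `annihilating_and_null_iff`. Let (u, w) be null. Pairing with the vertical vectors (0,
w'), where w' annihilates D_x, forces u = ∑ c_i S_i. Every u' lifts to a tangent vector (u', w'),
and pairing with it forces w = -∑ c_i α ∘ A_i. All that remains is that (u, w) itself be tangent,
which reads ∑ c_i α(A_j S_i - A_i S_j) = 0 for all j. The vector A_j S_i - A_i S_j is the bracket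
[S_i, S_j] at x, so this says that u is null for α ∘ Levi.

Thus u determines w and every null u of the Levi form occurs. If u = 0, then c = 0 by independence,
hence w = 0. Finally θ(u, w) = α(u) = 0 because u lies in D_x. -/

/-- The exterior derivative of a one-form on a vector space, on a pair of vectors. -/
theorem extDeriv_ofSubsingleton_apply {η : E → E →L[ℂ] ℂ} {y : E} (hη : DifferentiableAt ℂ η y)
    (v v' : E) :
    extDeriv (fun y ↦ ContinuousAlternatingMap.ofSubsingleton ℂ E ℂ (0 : Fin 1) (η y)) y ![v, v'] =
      fderiv ℂ (fun y ↦ η y v') y v - fderiv ℂ (fun y ↦ η y v) y v' := by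
  have hd : DifferentiableAt ℂ
      (fun y ↦ ContinuousAlternatingMap.ofSubsingleton ℂ E ℂ (0 : Fin 1) (η y)) y :=
    (ContinuousAlternatingMap.ofSubsingletonLIE (𝕜 := ℂ) (E := E) (F := ℂ)
      (0 : Fin 1)).differentiableAt.comp y hη
  rw [extDeriv_apply hd]
  simp [Fin.removeNth, sub_eq_add_neg]

/-- The exterior derivative of the one-form `p dq` on `E × E*`. -/
theorem extDeriv_snd_comp_fst (y : E × (E →L[ℂ] ℂ)) (v v' : E × (E →L[ℂ] ℂ)) :
    extDeriv (fun y : E × (E →L[ℂ] ℂ) ↦ ContinuousAlternatingMap.ofSubsingleton ℂ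
      (E × (E →L[ℂ] ℂ)) ℂ (0 : Fin 1) (y.2.comp (ContinuousLinearMap.fst ℂ E (E →L[ℂ] ℂ)))) y
      ![v, v'] = v.2 v'.1 - v'.2 v.1 := by
  have hf (u : E) (z : E × (E →L[ℂ] ℂ)) :
      fderiv ℂ (fun y : E × (E →L[ℂ] ℂ) ↦ y.2 u) y z = z.2 u := by
    rw [fderiv_clm_apply differentiableAt_snd (differentiableAt_const _)]
    simp [fderiv_snd]
  rw [extDeriv_ofSubsingleton_apply (differentiableAt_snd.clm_comp (differentiableAt_const _))]
  simp only [ContinuousLinearMap.comp_apply, ContinuousLinearMap.coe_fst', hf]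

/-- A covector annihilating a differentiable family of independent vectors moves along any line of
base points while staying in the annihilator, with any velocity allowed to first order. -/
theorem exists_curve_annihilating [FiniteDimensional ℂ E] {r : ℕ} {S : Fin r → E → E} {q u : E}
    {α w : E →L[ℂ] ℂ} (hS : ∀ i, DifferentiableAt ℂ (S i) q)
    (hli : LinearIndependent ℂ fun i ↦ S i q) (hα : ∀ i, α (S i q) = 0)
    (hw : ∀ i, w (S i q) + α (fderiv ℂ (S i) q u) = 0) :
    ∃ p : ℂ → E →L[ℂ] ℂ, p 0 = α ∧ HasDerivAt p w 0 ∧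
      ∀ᶠ t in 𝓝 (0 : ℂ), ∀ i, p t (S i (q + t • u)) = 0 := by
  classical
  obtain ⟨L₀, hL₀⟩ := LinearMap.exists_leftInverse_of_injective
    (Fintype.linearCombination ℂ fun i ↦ S i q)
    (LinearMap.ker_eq_bot.2 hli.fintypeLinearCombination_injective)
  -- `L` reads off coordinates in the frame at `q`. The matrix `B t` below expresses the moving
  -- frame through `L`; it is the identity at 0, hence invertible for small `t`.
  let L : E →L[ℂ] (Fin r → ℂ) := LinearMap.toContinuousLinearMap L₀
  have hL : ∀ c : Fin r → ℂ, L (∑ j, c j • S j q) = c := fun c ↦ by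
    simpa [L, Fintype.linearCombination_apply] using LinearMap.congr_fun hL₀ c
  have hline : HasDerivAt (fun t : ℂ ↦ q + t • u) u 0 := by
    simpa using ((hasDerivAt_id (0 : ℂ)).smul_const u).const_add q
  have hSt : ∀ i, HasDerivAt (fun t : ℂ ↦ S i (q + t • u)) (fderiv ℂ (S i) q u) 0 := fun i ↦ by
    have h : HasFDerivAt (S i) (fderiv ℂ (S i) q) (q + (0 : ℂ) • u) := by
      simpa using (hS i).hasFDerivAt
    exact h.comp_hasDerivAt 0 hline
  have hαt : HasDerivAt (fun t : ℂ ↦ α + t • w) w 0 := by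
    have h := ((hasDerivAt_id (0 : ℂ)).smul_const w).const_add α
    rwa [one_smul] at h
  let B : ℂ → ((Fin r → ℂ) →L[ℂ] (Fin r → ℂ)) := fun t ↦
    ∑ j, (ContinuousLinearMap.proj j : (Fin r → ℂ) →L[ℂ] ℂ).smulRight (L (S j (q + t • u)))
  have hB : ∀ t c, B t c = ∑ j, c j • L (S j (q + t • u)) := fun t c ↦ by simp [B]
  have hB0 : B 0 = 1 := by
    ext1 c
    rw [hB]
    simpa using hL c
  have hBd : DifferentiableAt ℂ B 0 := by
    refine DifferentiableAt.fun_sum fun j _ ↦ ?_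
    exact ((ContinuousLinearMap.smulRightL ℂ (Fin r → ℂ) (Fin r → ℂ)
      (ContinuousLinearMap.proj j)).differentiableAt).comp (0 : ℂ)
        (L.differentiableAt.comp (0 : ℂ) (hSt j).differentiableAt)
  have hunit : IsUnit (B 0) := hB0 ▸ isUnit_one
  have hBinv : DifferentiableAt ℂ (fun t ↦ Ring.inverse (B t)) 0 := hBd.inverse hunit
  -- The failure of the straight line `α + t • w` to annihilate the moving frame. Its value at 0
  -- vanishes by `hα` and its derivative by `hw`.
  let m : ℂ → ((Fin r → ℂ) →L[ℂ] ℂ) := fun t ↦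
    ∑ j, ((α + t • w) (S j (q + t • u))) • (ContinuousLinearMap.proj j : (Fin r → ℂ) →L[ℂ] ℂ)
  have hm0 : m 0 = 0 := by
    ext1 c
    simp [m, hα, sum_apply]
  have hm : HasDerivAt m 0 0 := by
    have h : ∀ j, HasDerivAt (fun t : ℂ ↦ (α + t • w) (S j (q + t • u))) 0 0 := fun j ↦ by
      simpa [hw j] using hαt.clm_apply (hSt j)
    have h' := HasDerivAt.fun_sum (u := Finset.univ) fun j _ ↦
      (h j).smul_const (ContinuousLinearMap.proj j : (Fin r → ℂ) →L[ℂ] ℂ)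
    have h0 : ∑ j : Fin r, (0 : ℂ) • (ContinuousLinearMap.proj j : (Fin r → ℂ) →L[ℂ] ℂ) = 0 := by
      ext1 c
      simp [sum_apply]
    exact h0 ▸ h'
  -- Both `m` and its derivative vanish at 0, so the derivative of the inverse matrix does not
  -- contribute.
  have hprod : HasDerivAt (fun t ↦ (m t).comp ((Ring.inverse (B t)).comp L)) 0 0 := by
    have h := hm.clm_comp (hBinv.hasDerivAt.clm_comp (hasDerivAt_const (0 : ℂ) L))
    simpa [hm0] using h
  -- The subtracted term takes the same values as the line on the moving frame, since `(B t)⁻¹ ∘ L`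
  -- sends its `i`-th vector to the `i`-th unit vector, and it changes neither position nor velocity
  -- at 0.
  refine ⟨fun t ↦ α + t • w - (m t).comp ((Ring.inverse (B t)).comp L), ?_, by simpa only [sub_zero] using hαt.fun_sub hprod, ?_⟩
  · ext1 v
    simp [hm0]
  filter_upwards [hBd.continuousAt.eventually (Units.isOpen.mem_nhds hunit)] with t ht i
  have h1 : L (S i (q + t • u)) = B t (Pi.single i 1) := by
    rw [hB]
    simp [Pi.single_apply]
  have h2 : Ring.inverse (B t) (B t (Pi.single i 1)) = Pi.single i 1 :=
    DFunLike.congr_fun (Ring.inverse_mul_cancel _ ht) _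
  rw [sub_apply, ContinuousLinearMap.comp_apply, ContinuousLinearMap.comp_apply,
    h1, h2, sub_eq_zero]
  simp [m, Pi.single_apply]

/-- A vector annihilated by all the covectors annihilating a subspace belongs to it. -/
theorem mem_span_of_forall_annihilating [FiniteDimensional ℂ E] {W : Submodule ℂ E} {u : E}
    (h : ∀ w : E →L[ℂ] ℂ, (∀ v ∈ W, w v = 0) → w u = 0) : u ∈ W := by
  by_contra hu
  obtain ⟨f, hf, hfW⟩ := W.exists_le_ker_of_notMem hu
  exact hf (h (LinearMap.toContinuousLinearMap f) fun v hv ↦ hfW hv)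

/-- A continuous linear form with prescribed values on independent vectors. -/
theorem exists_clm_eq_on_linearIndependent [FiniteDimensional ℂ E] {r : ℕ} {S : Fin r → E}
    (hli : LinearIndependent ℂ S) (b : Fin r → ℂ) : ∃ w : E →L[ℂ] ℂ, ∀ i, w (S i) = b i := by
  obtain ⟨g, hg⟩ := LinearMap.exists_extend ((Module.Basis.span hli).constr ℂ b)
  refine ⟨LinearMap.toContinuousLinearMap g, fun i ↦ ?_⟩
  have h := LinearMap.congr_fun hg (Module.Basis.span hli i)
  rw [Module.Basis.constr_basis] at h
  simpa [Module.Basis.span_apply] using h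

/-- The null vectors of the form `w(u') - w'(u)` on the space of the `(u, w)` with
`w(S i) + α (A i u) = 0` for all `i`. -/
theorem annihilating_and_null_iff [FiniteDimensional ℂ E] {r : ℕ} {S : Fin r → E}
    (hli : LinearIndependent ℂ S) {α : E →L[ℂ] ℂ} {A : Fin r → E →L[ℂ] E} {u : E}
    {w : E →L[ℂ] ℂ} :
    ((∀ i, w (S i) + α (A i u) = 0) ∧ ∀ (u' : E) (w' : E →L[ℂ] ℂ),
      (∀ i, w' (S i) + α (A i u') = 0) → w u' - w' u = 0) ↔
    ∃ c : Fin r → ℂ, u = ∑ i, c i • S i ∧ w = -∑ i, c i • α.comp (A i) ∧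
      ∀ j, ∑ i, c i • α (A j (S i) - A i (S j)) = 0 := by
  constructor
  · rintro ⟨hT, hN⟩
    have hu : u ∈ Submodule.span ℂ (range S) := by
      -- Test against the vertical vectors `(0, w')`, with `w'` annihilating the span.
      refine mem_span_of_forall_annihilating fun w' hw' ↦ ?_
      have h := hN 0 w' fun i ↦ by
        simpa using hw' _ (Submodule.subset_span (mem_range_self i))
      simpa using h
    obtain ⟨c, rfl⟩ := (Submodule.mem_span_range_iff_exists_fun ℂ).1 hu
    have hw : w = -∑ i, c i • α.comp (A i) := by
      ext u'
      -- Independence of the `S i` allows any `u'` to be completed to an admissible `(u', w')`; the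
      -- pairing then gives `w u' = w' u`, which `hw'` evaluates.
      obtain ⟨w', hw'⟩ := exists_clm_eq_on_linearIndependent hli fun i ↦ -α (A i u')
      have h := hN u' w' fun i ↦ by rw [hw', neg_add_cancel]
      rw [sub_eq_zero.1 h]
      simp [hw']
    refine ⟨c, rfl, hw, fun j ↦ ?_⟩
    have h := hT j
    rw [hw] at h
    simp only [neg_apply, sum_apply,
      smul_apply, ContinuousLinearMap.comp_apply, map_sum, map_smul] at h
    simp only [map_sub, smul_sub, Finset.sum_sub_distrib]
    linear_combination h
  · rintro ⟨c, rfl, rfl, h⟩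
    refine ⟨fun j ↦ ?_, fun u' w' hw' ↦ ?_⟩
    · have hj := h j
      simp only [map_sub, smul_sub, Finset.sum_sub_distrib] at hj
      simp only [neg_apply, sum_apply,
        smul_apply, ContinuousLinearMap.comp_apply, map_sum, map_smul]
      linear_combination hj
    · have h' : ∀ i, w' (S i) = -α (A i u') := fun i ↦ eq_neg_of_add_eq_zero_left (hw' i)
      simp [h']

end VectorSpace

/-! ### The coordinates (q, p) on the cotangent bundle and its canonical forms. -/

section CotangentChart

variable {E : Type*} [NormedAddCommGroup E] [NormedSpace ℂ E]
  {M : Type*} [TopologicalSpace M] [ChartedSpace E M] [IsManifold 𝓘(ℂ, E) ω M]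

theorem mem_extChartAt_cotangent_source {a b : CotangentBundle E M} :
    b ∈ (extChartAt (cotangentModel E) a).source ↔ b.proj ∈ (chartAt E a.proj).source := by
  rw [extChartAt_source, FiberBundle.chartedSpace_chartAt]
  simp only [hom_trivializationAt_source, OpenPartialHomeomorph.trans_source,
    OpenPartialHomeomorph.prod_source, OpenPartialHomeomorph.refl_source, mem_inter_iff, mem_preimage,
    mem_prod, mem_univ, and_true, TangentBundle.trivializationAt_baseSet]
  exact ⟨fun h ↦ h.1.1, fun h ↦ ⟨⟨h, trivial⟩, h⟩⟩

theorem extChartAt_cotangent_fst (a b : CotangentBundle E M) :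
    (extChartAt (cotangentModel E) a b).1 = extChartAt 𝓘(ℂ, E) a.proj b.proj := by
  rw [FiberBundle.extChartAt]
  rfl

/-- The trivialization of the bundle of linear forms precomposes with the inverse of the tangent
trivialization, and that inverse is the derivative of the inverse chart of `M`. -/
theorem extChartAt_cotangent_snd {a b : CotangentBundle E M}
    (hb : b.proj ∈ (chartAt E a.proj).source) :
    (extChartAt (cotangentModel E) a b).2 = b.snd.comp
      (mfderivWithin 𝓘(ℂ, E) 𝓘(ℂ, E) (extChartAt 𝓘(ℂ, E) a.proj).symm (range 𝓘(ℂ, E))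
        (extChartAt 𝓘(ℂ, E) a.proj b.proj)) := by
  rw [← TangentBundle.symmL_trivializationAt hb, FiberBundle.extChartAt]
  ext v
  change (trivializationAt (E →L[ℂ] ℂ) (fun x : M ↦ TangentSpace 𝓘(ℂ, E) x →L[ℂ] ℂ) a.proj b).2 v
    = _
  rw [hom_trivializationAt_apply, ContinuousLinearMap.inCoordinates]
  simp only [Bundle.Trivial.fiberBundle_trivializationAt',
    Bundle.Trivial.continuousLinearMapAt_trivialization]
  rfl

/-- The derivative of the inverse chart is the identity at the centre of the chart, so no transition
map enters the formulas at `a`. -/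
theorem extChartAt_cotangent_self (a : CotangentBundle E M) :
    extChartAt (cotangentModel E) a a = (extChartAt 𝓘(ℂ, E) a.proj a.proj, a.snd) := by
  refine Prod.ext (extChartAt_cotangent_fst a a) ?_
  rw [extChartAt_cotangent_snd (mem_chart_source E a.proj), mfderivWithin_range_extChartAt_symm]
  rfl

theorem extChartAt_cotangent_symm_proj_mem {a : CotangentBundle E M} {y : E × (E →L[ℂ] ℂ)}
    (hy : y ∈ (extChartAt (cotangentModel E) a).target) :
    ((extChartAt (cotangentModel E) a).symm y).proj ∈ (chartAt E a.proj).source :=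
  mem_extChartAt_cotangent_source.1 ((extChartAt (cotangentModel E) a).map_target hy)

theorem extChartAt_cotangent_symm_proj {a : CotangentBundle E M} {y : E × (E →L[ℂ] ℂ)}
    (hy : y ∈ (extChartAt (cotangentModel E) a).target) :
    ((extChartAt (cotangentModel E) a).symm y).proj = (extChartAt 𝓘(ℂ, E) a.proj).symm y.1 := by
  have h := extChartAt_cotangent_fst a ((extChartAt (cotangentModel E) a).symm y)
  rw [(extChartAt (cotangentModel E) a).right_inv hy] at h
  rw [h, (extChartAt 𝓘(ℂ, E) a.proj).left_inv]
  rw [extChartAt_source]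
  exact extChartAt_cotangent_symm_proj_mem hy

theorem extChartAt_cotangent_target_fst {a : CotangentBundle E M} {y : E × (E →L[ℂ] ℂ)}
    (hy : y ∈ (extChartAt (cotangentModel E) a).target) :
    y.1 ∈ (extChartAt 𝓘(ℂ, E) a.proj).target := by
  have h := extChartAt_cotangent_fst a ((extChartAt (cotangentModel E) a).symm y)
  rw [(extChartAt (cotangentModel E) a).right_inv hy] at h
  rw [h]
  refine (extChartAt 𝓘(ℂ, E) a.proj).map_source ?_
  rw [extChartAt_source]
  exact extChartAt_cotangent_symm_proj_mem hy

/-- The covector with the coordinates `y`, evaluated on tangent vectors read in the chart of `M`. -/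
theorem extChartAt_cotangent_symm_snd {a : CotangentBundle E M} {y : E × (E →L[ℂ] ℂ)}
    (hy : y ∈ (extChartAt (cotangentModel E) a).target) (v : E) :
    ((extChartAt (cotangentModel E) a).symm y).snd
      (mfderivWithin 𝓘(ℂ, E) 𝓘(ℂ, E) (extChartAt 𝓘(ℂ, E) a.proj).symm (range 𝓘(ℂ, E)) y.1 v) =
      y.2 v := by
  have h := extChartAt_cotangent_snd (extChartAt_cotangent_symm_proj_mem hy)
  rw [← extChartAt_cotangent_fst, (extChartAt (cotangentModel E) a).right_inv hy] at h
  rw [h]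
  rfl

/-- The preferred chart at `a` lies over that at `a.proj`, so in these charts the projection is
`Prod.fst`. -/
theorem cotangentProjDeriv_apply (a : CotangentBundle E M)
    (v : TangentSpace (cotangentModel E) a) :
    cotangentProjDeriv a v = (show E × (E →L[ℂ] ℂ) from v).1 := by
  have hd : MDifferentiableAt (cotangentModel E) 𝓘(ℂ, E)
      (fun b : CotangentBundle E M ↦ b.proj) a :=
    (Bundle.contMDiffAt_proj (n := 1) (IB := 𝓘(ℂ, E)) (F := E →L[ℂ] ℂ)
      (fun x : M ↦ TangentSpace 𝓘(ℂ, E) x →L[ℂ] ℂ)).mdifferentiableAt one_ne_zero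
  have h : writtenInExtChartAt (cotangentModel E) 𝓘(ℂ, E) a
      (fun b : CotangentBundle E M ↦ b.proj) =ᶠ[𝓝 (extChartAt (cotangentModel E) a a)]
        Prod.fst := by
    filter_upwards [extChartAt_target_mem_nhds (I := cotangentModel E) a] with y hy
    change extChartAt 𝓘(ℂ, E) a.proj ((extChartAt (cotangentModel E) a).symm y).proj = y.1
    rw [← extChartAt_cotangent_fst, (extChartAt (cotangentModel E) a).right_inv hy]
  rw [cotangentProjDeriv, hd.mfderiv, ModelWithCorners.range_eq_univ, fderivWithin_univ,
    h.fderiv_eq, fderiv_fst]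
  rfl

/-- The canonical one-form is `p dq` in the coordinates of the cotangent bundle. -/
theorem canonicalOneForm_mfderivWithin_symm {a : CotangentBundle E M} {y : E × (E →L[ℂ] ℂ)}
    (hy : y ∈ (extChartAt (cotangentModel E) a).target) (v : E × (E →L[ℂ] ℂ)) :
    canonicalOneForm ((extChartAt (cotangentModel E) a).symm y)
      (mfderivWithin 𝓘(ℂ, E × (E →L[ℂ] ℂ)) (cotangentModel E)
        (extChartAt (cotangentModel E) a).symm (range (cotangentModel E)) y v) = y.2 v.1 := by
  have hb : MDifferentiableAt (cotangentModel E) 𝓘(ℂ, E)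
      (fun b : CotangentBundle E M ↦ b.proj) ((extChartAt (cotangentModel E) a).symm y) :=
    (Bundle.contMDiffAt_proj (n := 1) (IB := 𝓘(ℂ, E)) (F := E →L[ℂ] ℂ)
      (fun x : M ↦ TangentSpace 𝓘(ℂ, E) x →L[ℂ] ℂ)).mdifferentiableAt one_ne_zero
  have hr : range (cotangentModel E) = univ := ModelWithCorners.range_eq_univ _
  have hs : MDifferentiableAt 𝓘(ℂ, E × (E →L[ℂ] ℂ)) (cotangentModel E)
      (extChartAt (cotangentModel E) a).symm y := by
    have h := mdifferentiableWithinAt_extChartAt_symm (I := cotangentModel E) hy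
    rwa [hr, mdifferentiableWithinAt_univ] at h
  have hs' : MDifferentiableAt 𝓘(ℂ, E) 𝓘(ℂ, E) (extChartAt 𝓘(ℂ, E) a.proj).symm y.1 := by
    have h := mdifferentiableWithinAt_extChartAt_symm (I := 𝓘(ℂ, E))
      (extChartAt_cotangent_target_fst hy)
    rwa [ModelWithCorners.range_eq_univ, mdifferentiableWithinAt_univ] at h
  have hfst : MDifferentiableAt 𝓘(ℂ, E × (E →L[ℂ] ℂ)) 𝓘(ℂ, E)
      (Prod.fst : E × (E →L[ℂ] ℂ) → E) y :=
    differentiableAt_fst.mdifferentiableAt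
  -- Differentiating this identity moves the computation down to `M`, where the covector with
  -- coordinates `y` acts on chart vectors as `y.2`.
  have heq : (fun b : CotangentBundle E M ↦ b.proj) ∘ (extChartAt (cotangentModel E) a).symm
      =ᶠ[𝓝 y] (extChartAt 𝓘(ℂ, E) a.proj).symm ∘ Prod.fst := by
    filter_upwards [(isOpen_extChartAt_target a).mem_nhds hy] with z hz
    exact extChartAt_cotangent_symm_proj hz
  have h := heq.mfderiv_eq (I := 𝓘(ℂ, E × (E →L[ℂ] ℂ))) (I' := 𝓘(ℂ, E))
  rw [mfderiv_comp y hb hs, mfderiv_comp y hs' hfst] at h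
  have h' := extChartAt_cotangent_symm_snd hy v.1
  rw [ModelWithCorners.range_eq_univ, mfderivWithin_univ] at h' ⊢
  rw [← h']
  have h2 := DFunLike.congr_fun h v
  refine (congrArg ((extChartAt (cotangentModel E) a).symm y).snd h2).trans ?_
  rw [mfderiv_eq_fderiv, fderiv_fst]
  rfl

/-- The canonical symplectic form is `dp ∧ dq` in the coordinates of the cotangent bundle. -/
theorem canonicalTwoForm_apply (a : CotangentBundle E M)
    (v v' : TangentSpace (cotangentModel E) a) :
    canonicalTwoForm a ![v, v'] =
      (show E × (E →L[ℂ] ℂ) from v).2 (show E × (E →L[ℂ] ℂ) from v').1 -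
        (show E × (E →L[ℂ] ℂ) from v').2 (show E × (E →L[ℂ] ℂ) from v).1 := by
  have hr : range (cotangentModel E) = univ := ModelWithCorners.range_eq_univ _
  -- The identification with `p dq` is needed on a neighbourhood, as the exterior derivative depends
  -- on the germ.
  have h : (fun y : E × (E →L[ℂ] ℂ) ↦
      ContinuousAlternatingMap.ofSubsingleton ℂ (E × (E →L[ℂ] ℂ)) ℂ (0 : Fin 1)
        ((canonicalOneForm ((extChartAt (cotangentModel E) a).symm y)).comp
          (mfderivWithin 𝓘(ℂ, E × (E →L[ℂ] ℂ)) (cotangentModel E)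
            (extChartAt (cotangentModel E) a).symm (range (cotangentModel E)) y)))
      =ᶠ[𝓝 (extChartAt (cotangentModel E) a a)]
      (fun y : E × (E →L[ℂ] ℂ) ↦ ContinuousAlternatingMap.ofSubsingleton ℂ
      (E × (E →L[ℂ] ℂ)) ℂ (0 : Fin 1) (y.2.comp (ContinuousLinearMap.fst ℂ E (E →L[ℂ] ℂ)))) := by
    filter_upwards [extChartAt_target_mem_nhds (I := cotangentModel E) a] with y hy
    congr 1
    refine ContinuousLinearMap.ext fun v ↦ ?_
    exact canonicalOneForm_mfderivWithin_symm hy v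
  rw [canonicalTwoForm, exteriorDeriv, mfderiv_extChartAt_self, hr, extDerivWithin_univ]
  rw [hr] at h
  refine (DFunLike.congr_fun h.extDeriv_eq _).trans ?_
  exact extDeriv_snd_comp_fst _ v v'

end CotangentChart

/-! ### Vector fields and Lie brackets in a chart. -/

section ChartField

variable {E : Type*} [NormedAddCommGroup E] [NormedSpace ℂ E]
  {M : Type*} [TopologicalSpace M] [ChartedSpace E M]

/-- The vector field `X` read in the preferred chart at `x`. -/
noncomputable def chartField (x : M) (X : ∀ y : M, TangentSpace 𝓘(ℂ, E) y) : E → E :=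
  mpullbackWithin 𝓘(ℂ, E) 𝓘(ℂ, E) (extChartAt 𝓘(ℂ, E) x).symm X (range 𝓘(ℂ, E))

variable [IsManifold 𝓘(ℂ, E) ω M]

/-- The fibre at `x` is identified with `E` through the chart at `x` itself, whose derivative there
is the identity. -/
theorem chartField_self (x : M) (X : ∀ y : M, TangentSpace 𝓘(ℂ, E) y) :
    chartField x X (extChartAt 𝓘(ℂ, E) x x) = X x := by
  have h := mfderivWithin_extChartAt_symm_inverse_apply (I := 𝓘(ℂ, E)) (x := x) (X x)
  have hx : (extChartAt 𝓘(ℂ, E) x).symm (extChartAt 𝓘(ℂ, E) x x) = x := extChartAt_to_inv x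
  refine Eq.trans ?_ h
  have hX : ∀ z : M, z = x → (X z : E) = (X x : E) := by
    rintro z rfl
    rfl
  exact congrArg (mfderivWithin 𝓘(ℂ, E) 𝓘(ℂ, E) (extChartAt 𝓘(ℂ, E) x).symm (range 𝓘(ℂ, E))
    (extChartAt 𝓘(ℂ, E) x x)).inverse (hX _ hx)

theorem differentiableAt_chartField [CompleteSpace E] {x : M}
    {X : ∀ y : M, TangentSpace 𝓘(ℂ, E) y}
    (hX : MDifferentiableAt 𝓘(ℂ, E) 𝓘(ℂ, E).tangent
      (fun y ↦ (⟨y, X y⟩ : TangentBundle 𝓘(ℂ, E) M)) x) :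
    DifferentiableAt ℂ (chartField x X) (extChartAt 𝓘(ℂ, E) x x) := by
  have h := (mdifferentiableWithinAt_univ.2 hX).differentiableWithinAt_mpullbackWithin_vectorField
  rw [ModelWithCorners.range_eq_univ, preimage_univ, inter_univ] at h
  rw [chartField, ModelWithCorners.range_eq_univ]
  exact differentiableWithinAt_univ.1 h

theorem mlieBracket_eq_fderiv_chartField (x : M) (X Y : ∀ y : M, TangentSpace 𝓘(ℂ, E) y) :
    mlieBracket 𝓘(ℂ, E) X Y x =
      fderiv ℂ (chartField x Y) (extChartAt 𝓘(ℂ, E) x x) (X x) -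
        fderiv ℂ (chartField x X) (extChartAt 𝓘(ℂ, E) x x) (Y x) := by
  have h : lieBracket ℂ (chartField x X) (chartField x Y) (extChartAt 𝓘(ℂ, E) x x) =
      fderiv ℂ (chartField x Y) (extChartAt 𝓘(ℂ, E) x x) (X x) -
        fderiv ℂ (chartField x X) (extChartAt 𝓘(ℂ, E) x x) (Y x) := by
    simp only [lieBracket_eq, chartField_self]
  rw [← h, mlieBracket, mlieBracketWithin_apply, mfderiv_extChartAt_self, preimage_univ, univ_inter]
  refine (DFunLike.congr_fun (ContinuousLinearMap.inverse_id (R := ℂ) (M := E)) _).trans ?_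
  simp only [chartField, ModelWithCorners.range_eq_univ]
  exact congrFun (lieBracketWithin_univ (𝕜 := ℂ) (E := E)) _

/-- The pairing of covectors with vectors does not depend on coordinates. This puts the equations of
`D.perp` in the form `y.2 (S i y.1) = 0`. -/
theorem extChartAt_cotangent_snd_chartField {a : CotangentBundle E M} {y : E × (E →L[ℂ] ℂ)}
    (hy : y ∈ (extChartAt (cotangentModel E) a).target) (X : ∀ y : M, TangentSpace 𝓘(ℂ, E) y) :
    y.2 (chartField a.proj X y.1) = ((extChartAt (cotangentModel E) a).symm y).snd
      (X ((extChartAt (cotangentModel E) a).symm y).proj) := by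
  rw [← extChartAt_cotangent_symm_snd hy]
  refine congrArg ((extChartAt (cotangentModel E) a).symm y).snd ?_
  have hX : ∀ z z' : M, z = z' → (X z : E) = (X z' : E) := by
    rintro z _ rfl
    rfl
  refine Eq.trans ?_ (hX _ _ (extChartAt_cotangent_symm_proj hy)).symm
  exact (isInvertible_mfderivWithin_extChartAt_symm
    (extChartAt_cotangent_target_fst hy)).self_apply_inverse _

end ChartField

/-! ### The annihilator bundle and its tangent space in coordinates. -/

namespace HolomorphicDistribution

variable {E : Type*} [NormedAddCommGroup E] [NormedSpace ℂ E]
  {M : Type*} [TopologicalSpace M] [ChartedSpace E M] [IsManifold 𝓘(ℂ, E) ω M]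
  {D : HolomorphicDistribution E M}

/-- With `X` running over a frame of `D`, these functions cut out `D.perp`; being holomorphic, they
are admissible tests in `submanifoldTangentSpace`. -/
theorem contMDiffAt_snd_section {a : CotangentBundle E M} {X : ∀ y : M, TangentSpace 𝓘(ℂ, E) y}
    (hX : ContMDiffAt 𝓘(ℂ, E) 𝓘(ℂ, E).tangent ω
      (fun y ↦ (⟨y, X y⟩ : TangentBundle 𝓘(ℂ, E) M)) a.proj) :
    ContMDiffAt (cotangentModel E) 𝓘(ℂ, ℂ) ω
      (fun b : CotangentBundle E M ↦ b.snd (X b.proj)) a := by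
  have hproj : ContMDiffAt (cotangentModel E) 𝓘(ℂ, E) ω
      (fun b : CotangentBundle E M ↦ b.proj) a :=
    Bundle.contMDiffAt_proj (IB := 𝓘(ℂ, E)) (F := E →L[ℂ] ℂ)
      (fun x : M ↦ TangentSpace 𝓘(ℂ, E) x →L[ℂ] ℂ)
  have h1 : ContMDiffAt (cotangentModel E) (𝓘(ℂ, E).prod 𝓘(ℂ, E →L[ℂ] ℂ)) ω
      (fun b : CotangentBundle E M ↦ TotalSpace.mk' (E →L[ℂ] ℂ)
        (E := fun x : M ↦ TangentSpace 𝓘(ℂ, E) x →L[ℂ] Bundle.Trivial M ℂ x) b.proj b.snd) a :=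
    contMDiffAt_id
  have h2 : ContMDiffAt (cotangentModel E) (𝓘(ℂ, E).prod 𝓘(ℂ, E)) ω
      (fun b : CotangentBundle E M ↦ TotalSpace.mk' E
        (E := fun x : M ↦ TangentSpace 𝓘(ℂ, E) x) b.proj (X b.proj)) a :=
    ContMDiffAt.comp a hX hproj
  have h3 := ContMDiffAt.clm_bundle_apply (F₂ := ℂ) (E₂ := Bundle.Trivial M ℂ) h1 h2
  exact (Bundle.contMDiffAt_totalSpace.1 h3).2

theorem mem_perp_iff_frame {U : Set M} {r : ℕ} {s : Fin r → ∀ y : M, TangentSpace 𝓘(ℂ, E) y}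
    (hspan : ∀ y ∈ U, Submodule.span ℂ (range fun i ↦ s i y) = D.fiber y)
    {b : CotangentBundle E M} (hb : b.proj ∈ U) :
    b ∈ D.perp ↔ ∀ i, b.snd (s i b.proj) = 0 := by
  change (∀ v ∈ D.fiber b.proj, b.snd v = 0) ↔ _
  rw [← hspan _ hb]
  constructor
  · exact fun h i ↦ h _ (Submodule.subset_span (mem_range_self i))
  · intro h v hv
    have : Submodule.span ℂ (range fun i ↦ s i b.proj) ≤ LinearMap.ker b.snd.toLinearMap := by
      rw [Submodule.span_le]
      rintro _ ⟨i, rfl⟩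
      exact h i
    exact this hv

theorem canonicalOneForm_eq_perpProjDeriv {a : CotangentBundle E M} (v : D.perpTangent a) :
    canonicalOneForm a (v : TangentSpace (cotangentModel E) a) = a.snd (D.perpProjDeriv a v) :=
  rfl

theorem perpTwoForm_apply {a : CotangentBundle E M} (v v' : D.perpTangent a) :
    D.perpTwoForm a ![v, v'] =
      (show E × (E →L[ℂ] ℂ) from v.1).2 (show E × (E →L[ℂ] ℂ) from v'.1).1 -
        (show E × (E →L[ℂ] ℂ) from v'.1).2 (show E × (E →L[ℂ] ℂ) from v.1).1 := by
  rw [← canonicalTwoForm_apply]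
  exact congrArg (canonicalTwoForm a) (funext fun i ↦ by fin_cases i <;> rfl)

/-- The tangent space of `D.perp` in coordinates. -/
theorem mem_perpTangent_iff [FiniteDimensional ℂ E] {a : CotangentBundle E M} (ha : a ∈ D.perp)
    {U : Set M} {r : ℕ} {s : Fin r → ∀ y : M, TangentSpace 𝓘(ℂ, E) y} (hU : IsOpen U)
    (hx : a.proj ∈ U)
    (hs : ∀ i, ContMDiffOn 𝓘(ℂ, E) 𝓘(ℂ, E).tangent ω
      (fun y ↦ (⟨y, s i y⟩ : TangentBundle 𝓘(ℂ, E) M)) U)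
    (hspan : ∀ y ∈ U, LinearIndependent ℂ (fun i ↦ s i y) ∧
      Submodule.span ℂ (range fun i ↦ s i y) = D.fiber y)
    (v : E × (E →L[ℂ] ℂ)) :
    (show TangentSpace (cotangentModel E) a from v) ∈ D.perpTangent a ↔
      ∀ i, v.2 (s i a.proj) + a.snd (fderiv ℂ (chartField a.proj (s i))
        (extChartAt 𝓘(ℂ, E) a.proj a.proj) v.1) = 0 := by
  have : CompleteSpace E := FiniteDimensional.complete ℂ E
  have hsx : ∀ i, ContMDiffAt 𝓘(ℂ, E) 𝓘(ℂ, E).tangent ω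
      (fun y ↦ (⟨y, s i y⟩ : TangentBundle 𝓘(ℂ, E) M)) a.proj := fun i ↦
    (hs i).contMDiffAt (hU.mem_nhds hx)
  have hSd : ∀ i, DifferentiableAt ℂ (chartField a.proj (s i))
      (extChartAt 𝓘(ℂ, E) a.proj a.proj) := fun i ↦
    differentiableAt_chartField ((hsx i).mdifferentiableAt (by simp))
  have hproj : ContinuousAt (fun b : CotangentBundle E M ↦ b.proj) a :=
    (FiberBundle.continuous_proj (E →L[ℂ] ℂ)
      (fun x : M ↦ TangentSpace 𝓘(ℂ, E) x →L[ℂ] ℂ)).continuousAt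
  have hmf : ∀ f : CotangentBundle E M → ℂ, ContMDiffAt (cotangentModel E) 𝓘(ℂ, ℂ) ω f a →
      mfderiv (cotangentModel E) 𝓘(ℂ, ℂ) f a v =
        fderiv ℂ (f ∘ (extChartAt (cotangentModel E) a).symm)
          (extChartAt (cotangentModel E) a a) v := fun f hf ↦ by
    rw [(hf.mdifferentiableAt (by simp)).mfderiv, ModelWithCorners.range_eq_univ,
      fderivWithin_univ]
    rfl
  let q : E := extChartAt 𝓘(ℂ, E) a.proj a.proj
  let α : E →L[ℂ] ℂ := a.snd
  have hself : extChartAt (cotangentModel E) a a = (q, α) := extChartAt_cotangent_self a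
  constructor
  -- Necessity: apply the definition to the defining function of the `i`-th frame field and use the
  -- product rule.
  · intro hv i
    have hf := contMDiffAt_snd_section (hsx i)
    have h0 := hv _ hf (by
      filter_upwards [hproj.eventually (hU.mem_nhds hx)] with b hb hbD
      exact (mem_perp_iff_frame (fun y hy ↦ (hspan y hy).2) hb).1 hbD i)
    rw [hmf _ hf] at h0
    have heq : (fun b : CotangentBundle E M ↦ b.snd (s i b.proj)) ∘
        (extChartAt (cotangentModel E) a).symm =ᶠ[𝓝 (extChartAt (cotangentModel E) a a)]
        fun y : E × (E →L[ℂ] ℂ) ↦ y.2 (chartField a.proj (s i) y.1) := by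
      filter_upwards [extChartAt_target_mem_nhds (I := cotangentModel E) a] with y hy
      exact (extChartAt_cotangent_snd_chartField hy (s i)).symm
    have hd : DifferentiableAt ℂ (fun y : E × (E →L[ℂ] ℂ) ↦ chartField a.proj (s i) y.1)
        (q, α) :=
      DifferentiableAt.comp (g := chartField a.proj (s i))
        (q, α) (hSd i) differentiableAt_fst
    have hd' : fderiv ℂ (fun y : E × (E →L[ℂ] ℂ) ↦ chartField a.proj (s i) y.1)
        (q, α) v =
        fderiv ℂ (chartField a.proj (s i)) q v.1 := by
      have h := fderiv_comp (g := chartField a.proj (s i))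
        (f := (Prod.fst : E × (E →L[ℂ] ℂ) → E))
        (q, α) (hSd i) differentiableAt_fst
      rw [fderiv_fst] at h
      exact DFunLike.congr_fun h v
    rw [heq.fderiv_eq, hself, fderiv_clm_apply differentiableAt_snd hd] at h0
    rw [← chartField_self a.proj (s i), ← hd']
    simp only [fderiv_snd, add_apply, ContinuousLinearMap.comp_apply,
      ContinuousLinearMap.flip_apply, ContinuousLinearMap.coe_snd'] at h0
    exact (add_comm _ _).trans h0
  · intro hv f hf hfS
    rw [hmf f hf]
    have hp := (mem_perp_iff_frame (fun y hy ↦ (hspan y hy).2) hx).1 ha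
    -- Sufficiency: realize `v` as the velocity of a curve that stays in `D.perp` for small `t`. Any
    -- test function vanishes along it, so its derivative along `v` is zero.
    obtain ⟨p, hp0, hpd, hpv⟩ := exists_curve_annihilating (S := fun i ↦ chartField a.proj (s i))
      (q := q) (u := v.1) (w := v.2) (α := α) hSd
      (by simp only [q, chartField_self]; exact (hspan _ hx).1)
      (fun i ↦ by simp only [q, chartField_self]; exact hp i)
      (fun i ↦ by simp only [q, chartField_self]; exact hv i)
    let g : ℂ → E × (E →L[ℂ] ℂ) := fun t ↦ (q + t • v.1, p t)
    have hg0 : g 0 = extChartAt (cotangentModel E) a a := by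
      rw [hself]
      exact Prod.ext (by simp [g]) hp0
    have hline : HasDerivAt (fun t : ℂ ↦ q + t • v.1) v.1 0 := by
      simpa using ((hasDerivAt_id (0 : ℂ)).smul_const v.1).const_add q
    have hg : HasDerivAt g v 0 := hline.prodMk hpd
    have hfd : DifferentiableAt ℂ (f ∘ (extChartAt (cotangentModel E) a).symm)
        (extChartAt (cotangentModel E) a a) := by
      have h := (hf.mdifferentiableAt (by simp)).differentiableWithinAt_writtenInExtChartAt
      rw [ModelWithCorners.range_eq_univ, differentiableWithinAt_univ] at h
      exact h
    have hcomp : HasDerivAt ((f ∘ (extChartAt (cotangentModel E) a).symm) ∘ g)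
        (fderiv ℂ (f ∘ (extChartAt (cotangentModel E) a).symm)
          (extChartAt (cotangentModel E) a a) v) 0 := by
      have h := hfd.hasFDerivAt
      rw [← hg0] at h ⊢
      exact h.comp_hasDerivAt 0 hg
    have hgc : Tendsto g (𝓝 0) (𝓝 (extChartAt (cotangentModel E) a a)) :=
      hg0 ▸ hg.continuousAt
    have hsymm : Tendsto (extChartAt (cotangentModel E) a).symm
        (𝓝 (extChartAt (cotangentModel E) a a)) (𝓝 a) := by
      have h := continuousAt_extChartAt_symm (I := cotangentModel E) a
      rwa [ContinuousAt, extChartAt_to_inv] at h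
    have hzero : (f ∘ (extChartAt (cotangentModel E) a).symm) ∘ g =ᶠ[𝓝 0] fun _ ↦ 0 := by
      filter_upwards [(hsymm.comp hgc).eventually hfS,
        hgc.eventually (extChartAt_target_mem_nhds (I := cotangentModel E) a),
        ((hproj.tendsto.comp hsymm).comp hgc).eventually (hU.mem_nhds hx), hpv] with t h1 h2 h3 h4
      refine h1 ((mem_perp_iff_frame (fun y hy ↦ (hspan y hy).2) h3).2 fun i ↦ ?_)
      exact (extChartAt_cotangent_snd_chartField h2 (s i)).symm.trans (h4 i)
    exact hcomp.unique ((hasDerivAt_const (0 : ℂ) (0 : ℂ)).congr_of_eventuallyEq hzero)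

end HolomorphicDistribution

/-! ### Null spaces through spanning families, and restriction of a linear map to an equivalence. -/

section LinearAlgebra

variable {V : Type*} [AddCommGroup V] [Module ℂ V]

theorem mem_nullSpace_sum_smul_iff (β : V [⋀^Fin 2]→ₗ[ℂ] ℂ) {ι : Type*} [Fintype ι] {e : ι → V}
    (he : Submodule.span ℂ (range e) = ⊤) (c : ι → ℂ) :
    ∑ i, c i • e i ∈ nullSpace β ↔ ∀ j, ∑ i, c i • β ![e i, e j] = 0 := by
  have hsum : ∀ w, β ![∑ i, c i • e i, w] = ∑ i, c i • β ![e i, w] := fun w ↦ by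
    let L : V →ₗ[ℂ] ℂ :=
      { toFun := fun v ↦ β ![v, w]
        map_add' := β.map_vecCons_add (m := ![w])
        map_smul' := β.map_vecCons_smul (m := ![w]) }
    change L (∑ i, c i • e i) = ∑ i, c i • L (e i)
    simp only [map_sum, map_smul]
  constructor
  · intro h j
    rw [← hsum]
    exact h (e j)
  · intro h w
    -- Pairing with the fixed vector as a linear map in the second argument; vanishing on the
    -- spanning family then suffices.
    let f : V →ₗ[ℂ] V [⋀^Fin 0]→ₗ[ℂ] ℂ := (β.curryLeft (∑ i, c i • e i)).curryLeft
    have hf : Submodule.span ℂ (range e) ≤ LinearMap.ker f := by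
      rw [Submodule.span_le]
      rintro _ ⟨j, rfl⟩
      refine LinearMap.mem_ker.2 (AlternatingMap.ext fun m ↦ ?_)
      have hm : m = ![] := Subsingleton.elim _ _
      rw [hm]
      exact (hsum (e j)).trans (h j)
    rw [he] at hf
    exact DFunLike.congr_fun (LinearMap.mem_ker.1 (hf (Submodule.mem_top (x := w)))) ![]

/-- A linear map which is injective on `K` with image a submodule `N` of `S` restricts to a linear
equivalence of `K` and `N`. -/
theorem exists_linearEquiv_of_bijOn {T : Type*} [AddCommGroup T] [Module ℂ T] {P : V →ₗ[ℂ] T}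
    {K : Submodule ℂ V} {S : Submodule ℂ T} {N : Submodule ℂ S}
    (hmaps : ∀ v ∈ K, ∃ u : S, u ∈ N ∧ (u : T) = P v) (hinj : ∀ v ∈ K, P v = 0 → v = 0)
    (hsurj : ∀ u ∈ N, ∃ v ∈ K, P v = u) :
    ∃ e : K ≃ₗ[ℂ] N, ∀ v : K, ((e v : S) : T) = P v := by
  let f : K →ₗ[ℂ] S := (P.comp K.subtype).codRestrict S fun v ↦ by
    obtain ⟨u, -, hu⟩ := hmaps v.1 v.2
    exact hu ▸ u.2
  let g : K →ₗ[ℂ] N := f.codRestrict N fun v ↦ by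
    obtain ⟨u, hn, hu⟩ := hmaps v.1 v.2
    have h : f v = u := Subtype.ext hu.symm
    exact h ▸ hn
  refine ⟨LinearEquiv.ofBijective g ⟨?_, ?_⟩, fun _ ↦ rfl⟩
  · refine (injective_iff_map_eq_zero g).2 fun v hv ↦ Subtype.ext (hinj v.1 v.2 ?_)
    exact congrArg (fun n : N ↦ ((n : S) : T)) hv
  · intro u
    obtain ⟨v, hv, hu⟩ := hsurj u.1 u.2
    exact ⟨⟨v, hv⟩, Subtype.ext (Subtype.ext hu)⟩

end LinearAlgebra

/-! ### Null vectors of the symplectic form and of the Levi form. -/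

namespace HolomorphicDistribution

variable {E : Type*} [NormedAddCommGroup E] [NormedSpace ℂ E] [FiniteDimensional ℂ E]
  {M : Type*} [TopologicalSpace M] [ChartedSpace E M] [IsManifold 𝓘(ℂ, E) ω M]
  {D : HolomorphicDistribution E M}

/-- The coordinate formula for the bracket gives the Levi form the shape of the last condition in
`annihilating_and_null_iff`. -/
theorem leviForm_apply {x : M} (α : D.annihilator x) {X Y : ∀ y : M, TangentSpace 𝓘(ℂ, E) y}
    (hX : D.IsLocalSection x X) (hY : D.IsLocalSection x Y) :
    D.leviForm α ![⟨X x, hX.mem.self_of_nhds⟩, ⟨Y x, hY.mem.self_of_nhds⟩] =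
      (α : TangentSpace 𝓘(ℂ, E) x →L[ℂ] ℂ)
        (fderiv ℂ (chartField x Y) (extChartAt 𝓘(ℂ, E) x x) (X x) -
          fderiv ℂ (chartField x X) (extChartAt 𝓘(ℂ, E) x x) (Y x)) := by
  have h : D.leviForm α ![⟨X x, hX.mem.self_of_nhds⟩, ⟨Y x, hY.mem.self_of_nhds⟩] =
      (α : TangentSpace 𝓘(ℂ, E) x →L[ℂ] ℂ) (mlieBracket 𝓘(ℂ, E) X Y x) :=
    congrArg (D.quotientForm α) (D.levi_apply hX hY)
  rw [h, mlieBracket_eq_fderiv_chartField]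

/-- The null vectors of the canonical symplectic form on `D.perp` in terms of a frame of `D`. -/
theorem mem_nullSpace_perpTwoForm_iff {x : M} (α : D.annihilator x)
    {U : Set M} {r : ℕ} {s : Fin r → ∀ y : M, TangentSpace 𝓘(ℂ, E) y} (hU : IsOpen U)
    (hx : x ∈ U)
    (hs : ∀ i, ContMDiffOn 𝓘(ℂ, E) 𝓘(ℂ, E).tangent ω
      (fun y ↦ (⟨y, s i y⟩ : TangentBundle 𝓘(ℂ, E) M)) U)
    (hspan : ∀ y ∈ U, LinearIndependent ℂ (fun i ↦ s i y) ∧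
      Submodule.span ℂ (range fun i ↦ s i y) = D.fiber y)
    (u : E) (w : E →L[ℂ] ℂ) :
    (∃ h : (show TangentSpace (cotangentModel E) (⟨x, α⟩ : CotangentBundle E M) from (u, w)) ∈
        D.perpTangent ⟨x, α⟩, (⟨_, h⟩ : D.perpTangent ⟨x, α⟩) ∈ nullSpace (D.perpTwoForm ⟨x, α⟩)) ↔
    ∃ c : Fin r → ℂ, u = ∑ i, c i • (show E from s i x) ∧
      w = -∑ i, c i • (show E →L[ℂ] ℂ from (α : TangentSpace 𝓘(ℂ, E) x →L[ℂ] ℂ)).comp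
        (fderiv ℂ (chartField x (s i)) (extChartAt 𝓘(ℂ, E) x x)) ∧
      ∑ i, c i • (⟨s i x, (hspan x hx).2.le (Submodule.subset_span (mem_range_self i))⟩ :
        D.fiber x) ∈ nullSpace (D.leviForm α) := by
  have hsec : ∀ i, D.IsLocalSection x (s i) := fun i ↦
    ⟨(hs i).contMDiffAt (hU.mem_nhds hx), by
      filter_upwards [hU.mem_nhds hx] with y hy
      exact (hspan y hy).2.le (Submodule.subset_span (mem_range_self i))⟩
  have htop : Submodule.span ℂ (range fun i ↦
      (⟨s i x, (hspan x hx).2.le (Submodule.subset_span (mem_range_self i))⟩ : D.fiber x)) = ⊤ := by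
    refine Submodule.map_injective_of_injective (D.fiber x).injective_subtype ?_
    rw [Submodule.map_span, Submodule.map_top, Submodule.range_subtype, ← range_comp]
    exact (hspan x hx).2
  have hT := mem_perpTangent_iff (D := D) (a := ⟨x, α⟩) α.2 hU hx hs hspan
  have key := annihilating_and_null_iff (S := fun i ↦ (show E from s i x)) (hspan x hx).1
    (α := (show E →L[ℂ] ℂ from (α : TangentSpace 𝓘(ℂ, E) x →L[ℂ] ℂ)))
    (A := fun i ↦ fderiv ℂ (chartField x (s i)) (extChartAt 𝓘(ℂ, E) x x)) (u := u) (w := w)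
  refine Iff.trans ⟨?_, ?_⟩ (key.trans (exists_congr fun c ↦ and_congr_right fun _ ↦
    and_congr_right fun _ ↦ ?_))
  · rintro ⟨h, hn⟩
    refine ⟨(hT (u, w)).1 h, fun u' w' h' ↦ ?_⟩
    exact (perpTwoForm_apply _ _).symm.trans (hn ⟨_, (hT (u', w')).2 h'⟩)
  · rintro ⟨h, hn⟩
    refine ⟨(hT (u, w)).2 h, ?_⟩
    rintro ⟨⟨u', w'⟩, h'⟩
    exact (perpTwoForm_apply _ _).trans (hn u' w' ((hT (u', w')).1 h'))
  · rw [mem_nullSpace_sum_smul_iff _ htop]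
    refine forall_congr' fun j ↦ ?_
    rw [Finset.sum_congr rfl fun i _ ↦ congrArg (c i • ·) (leviForm_apply α (hsec i) (hsec j))]
    rfl

end HolomorphicDistribution

theorem proposition3p5 {E : Type*} [NormedAddCommGroup E] [NormedSpace ℂ E]
    [FiniteDimensional ℂ E] {M : Type*} [TopologicalSpace M] [ChartedSpace E M]
    [IsManifold 𝓘(ℂ, E) ω M] (D : HolomorphicDistribution E M) (x : M)
    (α : D.annihilator x) (hα : α ≠ 0) :
    nullSpace (D.perpTwoForm ⟨x, α⟩) ⊓ LinearMap.ker (D.perpProjDeriv ⟨x, α⟩) = ⊥ ∧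
    (∃ e : nullSpace (D.perpTwoForm ⟨x, α⟩) ≃ₗ[ℂ] nullSpace (D.leviForm α),
      ∀ v : nullSpace (D.perpTwoForm ⟨x, α⟩),
        (((e v : D.fiber x) : TangentSpace 𝓘(ℂ, E) x)) =
          D.perpProjDeriv ⟨x, α⟩ (v : D.perpTangent ⟨x, α⟩)) ∧
    ∀ v ∈ nullSpace (D.perpTwoForm ⟨x, α⟩),
      canonicalOneForm ⟨x, α⟩ (v : TangentSpace (cotangentModel E) (⟨x, α⟩ : CotangentBundle E M))
        = 0 := by
  obtain ⟨U, r, s, hU, hx, hs, hspan⟩ := D.exists_frame x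
  have key := HolomorphicDistribution.mem_nullSpace_perpTwoForm_iff α hU hx hs hspan
  have hproj : ∀ v : D.perpTangent ⟨x, α⟩, D.perpProjDeriv ⟨x, α⟩ v =
      (show E × (E →L[ℂ] ℂ) from v.1).1 := fun v ↦ cotangentProjDeriv_apply _ _
  have hmem : ∀ v ∈ nullSpace (D.perpTwoForm ⟨x, α⟩), ∃ u : D.fiber x,
      u ∈ nullSpace (D.leviForm α) ∧ (u : TangentSpace 𝓘(ℂ, E) x) = D.perpProjDeriv ⟨x, α⟩ v := by
    rintro ⟨⟨u, w⟩, h⟩ hv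
    obtain ⟨c, hu, -, hc⟩ := (key u w).1 ⟨h, hv⟩
    refine ⟨_, hc, ?_⟩
    rw [hproj, Submodule.coe_sum]
    exact hu.symm
  have hinj : nullSpace (D.perpTwoForm ⟨x, α⟩) ⊓ LinearMap.ker (D.perpProjDeriv ⟨x, α⟩) = ⊥ := by
    refine (Submodule.eq_bot_iff _).2 ?_
    rintro ⟨⟨u, w⟩, h⟩ ⟨hv, hv0⟩
    obtain ⟨c, hu, hw, -⟩ := (key u w).1 ⟨h, hv⟩
    have hu0 : u = 0 := (hproj _).symm.trans (LinearMap.mem_ker.1 hv0)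
    have hc : ∀ i, c i = 0 :=
      Fintype.linearIndependent_iff.1 (hspan x hx).1 c (hu.symm.trans hu0)
    have hw0 : w = 0 := by
      refine hw.trans (neg_eq_zero.2 (Finset.sum_eq_zero fun i _ ↦ ?_))
      rw [hc i]
      exact zero_smul ℂ (_ : E →L[ℂ] ℂ)
    exact Subtype.ext (Prod.ext hu0 hw0)
  have hker : ∀ v ∈ nullSpace (D.perpTwoForm ⟨x, α⟩), D.perpProjDeriv ⟨x, α⟩ v = 0 → v = 0 :=
    fun v hv h0 ↦ (Submodule.mem_bot ℂ).1 (hinj.le ⟨hv, LinearMap.mem_ker.2 h0⟩)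
  refine ⟨hinj, ?_, ?_⟩
  · refine exists_linearEquiv_of_bijOn hmem hker ?_
    rintro ⟨u, hu⟩ hn
    obtain ⟨c, hc⟩ := (Submodule.mem_span_range_iff_exists_fun ℂ).1 ((hspan x hx).2.ge hu)
    have hsum : ∑ i, c i • (⟨s i x, (hspan x hx).2.le
        (Submodule.subset_span (mem_range_self i))⟩ : D.fiber x) = ⟨u, hu⟩ := by
      refine Subtype.ext ?_
      rw [Submodule.coe_sum]
      exact hc
    rw [← hsum] at hn
    -- The lift of `u` has no freedom: `rfl` makes `w` the combination -∑ c_i α ∘ A_i prescribed by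
    -- `key`.
    have hex := (fun w hw ↦ (key u w).2 ⟨c, hc.symm, hw, hn⟩) _ rfl
    exact ⟨_, hex.choose_spec, hproj _⟩
  · intro v hv
    obtain ⟨u, -, hu⟩ := hmem v hv
    exact (HolomorphicDistribution.canonicalOneForm_eq_perpProjDeriv v).trans
      ((congrArg (α : TangentSpace 𝓘(ℂ, E) x →L[ℂ] ℂ) hu.symm).trans (α.2 u u.2))
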